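/- Let $d\ge 1$ and let $B_1\subset\mathbb{R}^d$ be the open unit ball. There is a constant $C_d>0$, depending only on $d$, such that the following holds. Let $g\in H^1(B_1)$ be non-negative and set $$\mathcal K_{ob}=\{u\in H^1(B_1): u-g\in H^1_0(B_1),\ u\ge 0\text{ in }B_1\},\qquad \mathcal F_{ob}(u)=\frac12\int_{B_1}|\nabla u|^2\,dx+\int_{B_1}u\,dx,$$ and, for $u\in H^2(B_1)$, let $\nabla\mathcal F_{ob}(u)=-\Delta u+1\in L^2(B_1)$. For $u\in H^2(B_1)\cap\mathcal K_{ob}$ define $$\|\nabla\mathcal F_{ob}(u)\|_{\mathcal K_{ob}}=\sup\Big\{0,\ \sup_{v\in\mathcal K_{ob}\setminus\{u\}}\frac{-\langle v-u,\nabla\mathcal F_{ob}(u)\rangle_{L^2(B_1)}}{\|v-u\|_{L^2(B_1)}}\Big\}.$$ Let $\varphi\in\mathcal K_{ob}$ be the solution of the obstacle problem, i.e. the minimizer of $\mathcal F_{ob}$ over $\mathcal K_{ob}$. Then $$\big(\mathcal F_{ob}(u)-\mathcal F_{ob}(\varphi)\big)^{1/2}\le C_d\,\|\nabla\mathcal F_{ob}(u)\|_{\mathcal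 K_{ob}}\qquad\text{for every }u\in H^2(B_1)\cap\mathcal K_{ob}.$$ -/

import Mathlib

open MeasureTheory Set Filter Topology
open scoped Distributions LineDeriv RealInnerProductSpace

noncomputable section

namespace ObstacleBall

/-- The `j`-th vector of the standard basis of `ℝᵈ`. -/
abbrev stdVec {d : ℕ} (j : Fin d) : EuclideanSpace ℝ (Fin d) := EuclideanSpace.single j 1

/-- The open unit ball `B₁ ⊂ ℝᵈ`, bundled as an open set. -/
def unitBall (d : ℕ) : TopologicalSpace.Opens (EuclideanSpace ℝ (Fin d)) :=
  ⟨Metric.ball 0 1, Metric.isOpen_ball⟩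

/-- Lebesgue measure on `B₁`. -/
abbrev ballVol (d : ℕ) : Measure (EuclideanSpace ℝ (Fin d)) :=
  volume.restrict (Metric.ball 0 1)

instance (d : ℕ) : IsFiniteMeasure (ballVol d) :=
  isFiniteMeasure_restrict.2 measure_ball_lt_top.ne

/-- The Hilbert space `L²(B₁)` of (classes of) real functions. -/
abbrev L2Ball (d : ℕ) : Type := Lp ℝ 2 (ballVol d)

/-- The space `C_c^∞(B₁)` of test functions. -/
abbrev Test (d : ℕ) : Type := 𝓓(unitBall d, ℝ)

theorem memLp_test {d : ℕ} (η : Test d) : MemLp (η : EuclideanSpace ℝ (Fin d) → ℝ) 2 (ballVol d) :=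
  η.continuous.memLp_of_hasCompactSupport η.hasCompactSupport

/-- A test function as an element of `L²(B₁)`. -/
def Test.toL2 {d : ℕ} (η : Test d) : L2Ball d := (memLp_test η).toLp η

/-- `w ∈ L²(B₁)` is the weak partial derivative `∂ⱼu` of `u ∈ L²(B₁)`:
`∫ u ∂ⱼη = - ∫ w η` for every `η ∈ C_c^∞(B₁)`. -/
def HasWeakPartial {d : ℕ} (j : Fin d) (u w : L2Ball d) : Prop :=
  ∀ η : Test d,
    ∫ x in Metric.ball 0 1, u x * (∂_{stdVec j} η) x = - ∫ x in Metric.ball 0 1, w x * η x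

/-- Weak partial derivatives are unique. -/
theorem HasWeakPartial.unique {d : ℕ} {j : Fin d} {u w w' : L2Ball d}
    (h : HasWeakPartial j u w) (h' : HasWeakPartial j u w') : w = w' := by
  have hi : ∀ v : L2Ball d, IntegrableOn v (Metric.ball 0 1) volume := fun v =>
    (Lp.memLp v).integrable (by norm_num)
  have key : ∀ᵐ x ∂(volume : Measure (EuclideanSpace ℝ (Fin d))),
      x ∈ Metric.ball (0 : EuclideanSpace ℝ (Fin d)) 1 → w x - w' x = 0 := by
    refine Metric.isOpen_ball.ae_eq_zero_of_integral_contDiff_smul_eq_zero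
      (((hi w).sub (hi w')).locallyIntegrableOn) ?_
    intro g hg hc hs
    let η : Test d := ⟨g, hg, hc, hs⟩
    have e := (h η).symm.trans (h' η)
    have hη : ∀ v : L2Ball d, Integrable (fun x => v x * η x) (ballVol d) := fun v =>
      (Lp.memLp v).integrable_mul (memLp_test η)
    have e2 : ∫ x in Metric.ball 0 1, (w x * η x - w' x * η x) = 0 := by
      rw [integral_sub (hη w) (hη w')]
      linarith
    have e3 : ∫ x, g x • (w x - w' x) = ∫ x in Metric.ball 0 1, g x • (w x - w' x) := by
      symm
      refine setIntegral_eq_integral_of_forall_compl_eq_zero fun x hx => ?_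
      have : g x = 0 := image_eq_zero_of_notMem_tsupport fun hx' => hx (hs hx')
      simp [this]
    rw [e3, ← e2]
    refine integral_congr_ae (Eventually.of_forall fun x => ?_)
    change g x * (w x - w' x) = w x * g x - w' x * g x
    ring
  refine Lp.ext ?_
  filter_upwards [(ae_restrict_iff' measurableSet_ball).2 key] with x hx
  exact sub_eq_zero.1 hx

open Classical in
/-- The weak partial derivative `∂ⱼu` (set to `0` if `u` has none in `L²(B₁)`). -/
def weakPartial {d : ℕ} (j : Fin d) (u : L2Ball d) : L2Ball d :=
  if h : ∃ w, HasWeakPartial j u w then h.choose else 0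

theorem HasWeakPartial.weakPartial_eq {d : ℕ} {j : Fin d} {u w : L2Ball d}
    (h : HasWeakPartial j u w) : weakPartial j u = w := by
  have hex : ∃ w, HasWeakPartial j u w := ⟨w, h⟩
  rw [weakPartial, dif_pos hex]
  exact hex.choose_spec.unique h

/-- The Sobolev space `H¹(B₁)`. -/
def H1 (d : ℕ) : Set (L2Ball d) := {u | ∀ j, ∃ w, HasWeakPartial j u w}

/-- The Sobolev space `H²(B₁)`. -/
def H2 (d : ℕ) : Set (L2Ball d) := {u | u ∈ H1 d ∧ ∀ j, weakPartial j u ∈ H1 d}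

/-- The space `H¹₀(B₁)`: the closure of `C_c^∞(B₁)` in `H¹(B₁)`. -/
def H10 (d : ℕ) : Set (L2Ball d) :=
  {u | u ∈ H1 d ∧ ∃ η : ℕ → Test d,
    Tendsto (fun n => (η n).toL2) atTop (𝓝 u) ∧
    ∀ j, Tendsto (fun n => (∂_{stdVec j} (η n) : Test d).toL2) atTop (𝓝 (weakPartial j u))}

/-- The Laplacian `Δu = ∑ⱼ ∂ⱼ∂ⱼu` (meaningful for `u ∈ H²(B₁)`). -/
def laplacian {d : ℕ} (u : L2Ball d) : L2Ball d := ∑ j, weakPartial j (weakPartial j u)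

/-- The admissible set
`K_ob = {u ∈ H¹(B₁) : u - g ∈ H¹₀(B₁), u ≥ 0 in B₁}`; `0 ≤ u` is meant a.e. in `B₁`. -/
def admissible {d : ℕ} (g : L2Ball d) : Set (L2Ball d) :=
  {u | u ∈ H1 d ∧ u - g ∈ H10 d ∧ 0 ≤ u}

/-- The obstacle energy `F_ob(u) = ½ ∫ |∇u|² + ∫ u` (meaningful for `u ∈ H¹(B₁)`). -/
def energy {d : ℕ} (u : L2Ball d) : ℝ :=
  (1 / 2) * (∫ x in Metric.ball 0 1, ∑ j, (weakPartial j u x) ^ 2) +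
    ∫ x in Metric.ball 0 1, u x

/-- The `L²(B₁)`-gradient `∇F_ob(u) = -Δu + 1` of the energy (meaningful for `u ∈ H²(B₁)`). -/
def energyGrad {d : ℕ} (u : L2Ball d) : L2Ball d :=
  - laplacian u + Lp.const 2 (ballVol d) (1 : ℝ)

/-- For a subset `K` of a Hilbert space and a point `u`, the constrained norm of `ξ` at `u`:
`‖ξ‖_K = sup {0, sup_{v ∈ K \ {u}} -(v - u) · ξ / ‖v - u‖}`. -/
def constrainedNorm {H : Type*} [NormedAddCommGroup H] [InnerProductSpace ℝ H]
    (K : Set H) (u ξ : H) : ℝ :=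
  sSup (insert 0 ((fun v => -⟪v - u, ξ⟫ / ‖v - u‖) '' (K \ {u})))

/-- The supremum defining the constrained norm is over a bounded set. -/
theorem bddAbove_constrainedNorm {H : Type*} [NormedAddCommGroup H] [InnerProductSpace ℝ H]
    (K : Set H) (u ξ : H) :
    BddAbove (insert 0 ((fun v => -⟪v - u, ξ⟫ / ‖v - u‖) '' (K \ {u}))) := by
  refine ⟨‖ξ‖, ?_⟩
  rintro _ (rfl | ⟨v, -, rfl⟩)
  · exact norm_nonneg ξ
  · refine div_le_of_le_mul₀ (norm_nonneg _) (norm_nonneg _) ?_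
    have h := abs_real_inner_le_norm (v - u) ξ
    have h2 := neg_abs_le ⟪v - u, ξ⟫
    linarith [mul_comm ‖v - u‖ ‖ξ‖]

end ObstacleBall

end

namespace ObstacleBall

variable {d : ℕ}

/-! The energy is quadratic with leading part the Dirichlet integral, so with `w = φ - u ∈ H¹₀` it
expands exactly (`energy_sub_energy`): `F(u) - F(φ) = -⟪w, ∇F(u)⟫ - ½‖∇w‖²`. Let `N` be the
constrained norm. Since `φ` is an admissible competitor, the linear term is at most `N‖w‖`, and
Poincaré's inequality in a single direction (`norm_le_of_mem_H10`) gives `‖w‖ ≤ 2p` with `p =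
‖∂ⱼw‖`. The quadratic term absorbs the result: `2Np - ½p² ≤ 2N² ≤ (2N)²`. Hence `C = 2` works in
every dimension. -/

theorem inner_toL2 (u : L2Ball d) (η : Test d) :
    ⟪u, η.toL2⟫ = ∫ x in Metric.ball 0 1, u x * η x := by
  rw [L2.inner_def]
  refine integral_congr_ae ?_
  filter_upwards [(memLp_test η).coeFn_toLp] with x hx
  simp only [Test.toL2, hx, RCLike.inner_apply, conj_trivial]
  ring

/-- In this form linearity and passage to `L²` limits follow from those of the inner product. -/
theorem hasWeakPartial_iff_inner {j : Fin d} {u w : L2Ball d} :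
    HasWeakPartial j u w ↔
      ∀ η : Test d, ⟪u, (∂_{stdVec j} η : Test d).toL2⟫ = -⟪w, η.toL2⟫ := by
  simp only [HasWeakPartial, inner_toL2]

theorem HasWeakPartial.sub {j : Fin d} {u v w z : L2Ball d}
    (h : HasWeakPartial j u w) (h' : HasWeakPartial j v z) :
    HasWeakPartial j (u - v) (w - z) := by
  rw [hasWeakPartial_iff_inner] at *
  intro η
  rw [inner_sub_left, inner_sub_left, h, h']
  ring

theorem hasWeakPartial_weakPartial {u : L2Ball d} (hu : u ∈ H1 d) (j : Fin d) :
    HasWeakPartial j u (weakPartial j u) := by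
  obtain ⟨w, hw⟩ := hu j
  rwa [hw.weakPartial_eq]

theorem H1.sub {u v : L2Ball d} (hu : u ∈ H1 d) (hv : v ∈ H1 d) : u - v ∈ H1 d := fun j =>
  ⟨_, (hasWeakPartial_weakPartial hu j).sub (hasWeakPartial_weakPartial hv j)⟩

theorem weakPartial_sub {u v : L2Ball d} (hu : u ∈ H1 d) (hv : v ∈ H1 d) (j : Fin d) :
    weakPartial j (u - v) = weakPartial j u - weakPartial j v :=
  ((hasWeakPartial_weakPartial hu j).sub (hasWeakPartial_weakPartial hv j)).weakPartial_eq

theorem toL2_sub (η ζ : Test d) : (η - ζ).toL2 = η.toL2 - ζ.toL2 :=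
  MemLp.toLp_sub (memLp_test η) (memLp_test ζ)

theorem H10.sub {u v : L2Ball d} (hu : u ∈ H10 d) (hv : v ∈ H10 d) : u - v ∈ H10 d := by
  obtain ⟨hu1, η, hη, hη'⟩ := hu
  obtain ⟨hv1, ζ, hζ, hζ'⟩ := hv
  refine ⟨H1.sub hu1 hv1, fun n => η n - ζ n, ?_, fun j => ?_⟩
  · simpa only [toL2_sub] using hη.sub hζ
  · rw [weakPartial_sub hu1 hv1]
    have e : ∀ n, (∂_{stdVec j} (η n - ζ n) : Test d)
        = (∂_{stdVec j} (η n) : Test d) - (∂_{stdVec j} (ζ n) : Test d) := fun n =>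
      map_sub (TestFunction.lineDerivCLM ℝ (stdVec j)) (η n) (ζ n)
    simpa only [e, toL2_sub] using (hη' j).sub (hζ' j)

/-- Integration by parts against a function of `H¹₀(B₁)`. -/
theorem inner_weakPartial_eq_neg {u w v : L2Ball d} {j : Fin d} (hu : HasWeakPartial j u w)
    (hv : v ∈ H10 d) : ⟪u, weakPartial j v⟫ = -⟪w, v⟫ := by
  obtain ⟨-, η, hη, hη'⟩ := hv
  rw [hasWeakPartial_iff_inner] at hu
  -- The identity holds for each approximating test function by definition of the weak derivative;
  -- both sides converge.
  refine tendsto_nhds_unique (tendsto_const_nhds.inner (hη' j)) ?_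
  simp only [hu]
  exact (tendsto_const_nhds.inner hη).neg

theorem lineDeriv_test_apply (η : Test d) (v x : EuclideanSpace ℝ (Fin d)) :
    (∂_{v} η : Test d) x = fderiv ℝ η x v := by
  change (TestFunction.lineDerivCLM ℝ v η : Test d) x = _
  rw [TestFunction.lineDerivCLM_apply_of_le (by simp)]
  exact ((η.contDiff.differentiable (by simp)).differentiableAt).lineDeriv_eq_fderiv

/-- Integrate by parts `xⱼ` against `∂ⱼ(η²) = 2η ∂ⱼη`, using `∂ⱼxⱼ = 1`. This is the source of the
Poincaré constant. -/
theorem integral_coord_mul_test (j : Fin d) (η : Test d) :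
    ∫ x in Metric.ball 0 1, η x * η x
      = -2 * ∫ x in Metric.ball 0 1, x j * (η x * (∂_{stdVec j} η : Test d) x) := by
  have hd : Differentiable ℝ η := η.contDiff.differentiable (by simp)
  set c : EuclideanSpace ℝ (Fin d) →L[ℝ] ℝ := EuclideanSpace.proj j
  have hc : ∀ x, fderiv ℝ (fun y : EuclideanSpace ℝ (Fin d) => y j) x (stdVec j) = 1 := fun x => by
    change fderiv ℝ c x (stdVec j) = 1
    rw [c.fderiv]
    simp [c]
  have hc0 : Continuous fun x : EuclideanSpace ℝ (Fin d) => x j := c.continuous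
  have hcd : Differentiable ℝ fun x : EuclideanSpace ℝ (Fin d) => x j := c.differentiable
  have hsq : ∀ x, fderiv ℝ (fun y => η y * η y) x (stdVec j)
      = 2 * (η x * (∂_{stdVec j} η : Test d) x) := fun x => by
    rw [lineDeriv_test_apply, fderiv_fun_mul hd.differentiableAt hd.differentiableAt]
    simp
    ring
  have hcs : HasCompactSupport fun x => η x * η x := η.hasCompactSupport.mul_left
  have key := integral_mul_fderiv_eq_neg_fderiv_mul_of_integrable
    (μ := (volume : Measure (EuclideanSpace ℝ (Fin d)))) (v := stdVec j)
    (f := fun x => x j) (g := fun x => η x * η x)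
    (by
      simp only [hc, one_mul]
      exact (η.continuous.mul η.continuous).integrable_of_hasCompactSupport hcs)
    (by
      simp only [hsq]
      refine Continuous.integrable_of_hasCompactSupport
        (hc0.mul (continuous_const.mul
          (η.continuous.mul (∂_{stdVec j} η : Test d).continuous))) ?_
      exact ((η.hasCompactSupport.mul_right).mul_left).mul_left)
    ((hc0.mul (η.continuous.mul η.continuous)).integrable_of_hasCompactSupport hcs.mul_left)
    (fun x _ => hcd.differentiableAt) (fun x _ => (hd.mul hd).differentiableAt)
  simp only [hc, hsq, one_mul] at key
  -- The integration by parts is over the whole space; vanishing of `η` off the ball brings it back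
  -- to `B₁`.
  have hout : ∀ x ∉ Metric.ball (0 : EuclideanSpace ℝ (Fin d)) 1, η x = 0 := fun x hx =>
    image_eq_zero_of_notMem_tsupport fun hx' => hx (η.tsupport_subset hx')
  rw [setIntegral_eq_integral_of_forall_compl_eq_zero fun x hx => by simp [hout x hx],
    setIntegral_eq_integral_of_forall_compl_eq_zero fun x hx => by simp [hout x hx],
    ← neg_eq_iff_eq_neg.2 key, neg_mul, ← integral_const_mul]
  congr 2 with x
  ring

/-- Poincaré's inequality for test functions. -/
theorem norm_toL2_le (j : Fin d) (η : Test d) :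
    ‖η.toL2‖ ≤ 2 * ‖(∂_{stdVec j} η : Test d).toL2‖ := by
  set ζ : Test d := ∂_{stdVec j} η with hζ
  have hint : ∀ a b : Test d, Integrable (fun x => a x * b x) (ballVol d) := fun a b =>
    (memLp_test a).integrable_mul (memLp_test b)
  have habs : ∀ a : Test d, MemLp (fun x => |a x|) 2 (ballVol d) := fun a => (memLp_test a).abs
  have h1 : ‖η.toL2‖ ^ 2 = ∫ x in Metric.ball 0 1, η x * η x := by
    rw [← real_inner_self_eq_norm_sq, inner_toL2]
    refine integral_congr_ae ?_
    filter_upwards [(memLp_test η).coeFn_toLp] with x hx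
    simp only [Test.toL2, hx]
  -- Since `|xⱼ| ≤ 1` on the ball, the weight drops out and Cauchy–Schwarz applies to `|η|` and
  -- `|ζ|`.
  have h2 : |∫ x in Metric.ball 0 1, x j * (η x * ζ x)| ≤ ‖η.toL2‖ * ‖ζ.toL2‖ := by
    calc |∫ x in Metric.ball 0 1, x j * (η x * ζ x)|
        ≤ ∫ x in Metric.ball 0 1, |η x| * |ζ x| := by
          rw [← Real.norm_eq_abs]
          refine norm_integral_le_of_norm_le ((habs η).integrable_mul (habs ζ)) ?_
          filter_upwards [ae_restrict_mem measurableSet_ball] with x hx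
          have hx1 : |x j| ≤ 1 :=
            (PiLp.norm_apply_le x j).trans (mem_ball_zero_iff.1 hx).le
          rw [Real.norm_eq_abs, abs_mul, abs_mul]
          exact mul_le_of_le_one_left (by positivity) hx1
      _ = ⟪((habs η).toLp : L2Ball d), ((habs ζ).toLp : L2Ball d)⟫ := by
          rw [L2.inner_def]
          refine integral_congr_ae ?_
          filter_upwards [(habs η).coeFn_toLp, (habs ζ).coeFn_toLp] with x hx hx'
          simp [hx, hx', mul_comm]
      _ ≤ ‖(habs η).toLp‖ * ‖(habs ζ).toLp‖ := real_inner_le_norm _ _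
      _ = ‖η.toL2‖ * ‖ζ.toL2‖ := by
          have e : ∀ a : Test d, ‖(habs a).toLp‖ = ‖a.toL2‖ := fun a => by
            rw [Test.toL2, Lp.norm_toLp, Lp.norm_toLp]
            congr 1
            exact eLpNorm_norm (a : EuclideanSpace ℝ (Fin d) → ℝ)
          rw [e, e]
  have h3 := integral_coord_mul_test j η
  rw [← h1, ← hζ] at h3
  have h4 := neg_abs_le (∫ x in Metric.ball 0 1, x j * (η x * ζ x))
  rcases (norm_nonneg η.toL2).eq_or_lt' with h0 | h0
  · rw [h0]; positivity
  -- The estimates give `‖η‖² ≤ 2‖η‖‖ζ‖`; cancel one factor `‖η‖ > 0`.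
  · refine le_of_mul_le_mul_left ?_ h0
    nlinarith

/-- Poincaré's inequality in `H¹₀(B₁)`. -/
theorem norm_le_of_mem_H10 (j : Fin d) {v : L2Ball d} (hv : v ∈ H10 d) :
    ‖v‖ ≤ 2 * ‖weakPartial j v‖ := by
  obtain ⟨-, η, hη, hη'⟩ := hv
  exact le_of_tendsto_of_tendsto' hη.norm ((hη' j).norm.const_mul 2) fun n => norm_toL2_le j (η n)

/-- Turns the integrals into Hilbert space quantities, so that expanding the energy becomes algebra
in `L²`. -/
theorem energy_eq (u : L2Ball d) :
    energy u = (1 / 2) * ∑ j, ‖weakPartial j u‖ ^ 2 + ⟪u, Lp.const 2 (ballVol d) (1 : ℝ)⟫ := by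
  have hsq : ∀ w : L2Ball d, ∫ x in Metric.ball 0 1, w x ^ 2 = ‖w‖ ^ 2 := fun w => by
    rw [← real_inner_self_eq_norm_sq, L2.inner_def]
    refine integral_congr_ae (Eventually.of_forall fun x => ?_)
    simp
  rw [energy, integral_finsetSum _ fun j _ => (Lp.memLp (weakPartial j u)).integrable_sq]
  simp only [hsq]
  congr 1
  rw [L2.inner_def]
  refine integral_congr_ae ?_
  filter_upwards [Lp.coeFn_const 2 (ballVol d) (1 : ℝ)] with x hx
  rw [hx]
  simp

/-- Second order expansion of the energy at a point of `H²(B₁)`. -/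
theorem energy_sub_energy {u v : L2Ball d} (hu : u ∈ H2 d) (hv : v ∈ H1 d)
    (hvu : v - u ∈ H10 d) :
    energy u - energy v =
      -⟪v - u, energyGrad u⟫ - (1 / 2) * ∑ j, ‖weakPartial j (v - u)‖ ^ 2 := by
  -- Green's formula: `∂ⱼu` is itself in `H¹`, and `v - u ∈ H¹₀` leaves no boundary term.
  have hI : ∀ j, ⟪weakPartial j u, weakPartial j (v - u)⟫
      = -⟪weakPartial j (weakPartial j u), v - u⟫ := fun j =>
    inner_weakPartial_eq_neg (hasWeakPartial_weakPartial (hu.2 j) j) hvu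
  have hE : ∑ j, ‖weakPartial j v‖ ^ 2 = ∑ j, ‖weakPartial j u‖ ^ 2
      - 2 * ⟪v - u, laplacian u⟫ + ∑ j, ‖weakPartial j (v - u)‖ ^ 2 := by
    rw [laplacian, inner_sum, Finset.mul_sum, ← Finset.sum_sub_distrib, ← Finset.sum_add_distrib]
    refine Finset.sum_congr rfl fun j _ => ?_
    have e : weakPartial j v = weakPartial j u + weakPartial j (v - u) := by
      rw [weakPartial_sub hv hu.1]; abel
    rw [e, norm_add_sq_real, hI, real_inner_comm]
    ring
  rw [energy_eq, energy_eq, hE, energyGrad, inner_add_right, inner_neg_right,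
    inner_sub_left v u (Lp.const 2 (ballVol d) (1 : ℝ))]
  ring

section ConstrainedNorm

variable {H : Type*} [NormedAddCommGroup H] [InnerProductSpace ℝ H]

theorem constrainedNorm_nonneg (K : Set H) (u ξ : H) : 0 ≤ constrainedNorm K u ξ :=
  le_csSup (bddAbove_constrainedNorm K u ξ) (mem_insert _ _)

theorem neg_inner_le_constrainedNorm_mul {K : Set H} {v : H} (hv : v ∈ K) (u ξ : H) :
    -⟪v - u, ξ⟫ ≤ constrainedNorm K u ξ * ‖v - u‖ := by
  rcases eq_or_ne v u with rfl | hvu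
  · simp
  · rw [← div_le_iff₀ (norm_pos_iff.2 (sub_ne_zero.2 hvu))]
    exact le_csSup (bddAbove_constrainedNorm K u ξ)
      (mem_insert_of_mem _ ⟨v, ⟨hv, hvu⟩, rfl⟩)

end ConstrainedNorm

end ObstacleBall

theorem proposition4p1 (d : ℕ) (hd : 1 ≤ d) :
    ∃ C : ℝ, 0 < C ∧
      ∀ g ∈ ObstacleBall.H1 d, 0 ≤ g →
      ∀ φ ∈ ObstacleBall.admissible g,
        IsMinOn ObstacleBall.energy (ObstacleBall.admissible g) φ →
      ∀ u ∈ ObstacleBall.H2 d ∩ ObstacleBall.admissible g,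
        (ObstacleBall.energy u - ObstacleBall.energy φ) ^ (1 / 2 : ℝ) ≤
          C * ObstacleBall.constrainedNorm (ObstacleBall.admissible g) u
            (ObstacleBall.energyGrad u) := by
  refine ⟨2, two_pos, fun g _ _ φ hφ _ u ⟨hu2, hu⟩ => ?_⟩
  -- The boundary datum cancels in `(φ - g) - (u - g)`.
  have hw : φ - u ∈ ObstacleBall.H10 d := by
    simpa using ObstacleBall.H10.sub hφ.2.1 hu.2.1
  set N := ObstacleBall.constrainedNorm (ObstacleBall.admissible g) u (ObstacleBall.energyGrad u)
  have hN : 0 ≤ N := ObstacleBall.constrainedNorm_nonneg _ _ _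
  have hgrad := ObstacleBall.neg_inner_le_constrainedNorm_mul hφ u (ObstacleBall.energyGrad u)
  have hpoin := ObstacleBall.norm_le_of_mem_H10 ⟨0, hd⟩ hw
  have hsum := Finset.single_le_sum
    (f := fun j => ‖ObstacleBall.weakPartial j (φ - u)‖ ^ 2)
    (fun _ _ => sq_nonneg _) (Finset.mem_univ (⟨0, hd⟩ : Fin d))
  -- Keep only the direction `j = 0` of the Dirichlet term and complete the square: `2Np - ½p² = 2N²
  -- - ½(2N - p)²`.
  have hle : ObstacleBall.energy u - ObstacleBall.energy φ ≤ (2 * N) ^ 2 := by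
    rw [ObstacleBall.energy_sub_energy hu2 hφ.1 hw]
    nlinarith [mul_le_mul_of_nonneg_left hpoin hN,
      sq_nonneg (2 * N - ‖ObstacleBall.weakPartial ⟨0, hd⟩ (φ - u)‖), sq_nonneg N]
  rw [← Real.sqrt_eq_rpow]
  exact Real.sqrt_le_iff.2 ⟨by positivity, hle⟩
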